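/- Let $(T,\mathcal F,\mu)$ be a $\sigma$-finite measure space with $\mu(T)>0$, let $Y$ be a reflexive real Banach space, let $\varphi:Y\to\mathbb R$ be a nonzero continuous linear functional, and let $\psi:Y\to\mathbb R$ be a sequentially weakly lower semicontinuous functional of class $C^1$ with $$\lim_{\|y\|\to+\infty}\frac{\psi(y)}{\|y\|}=+\infty .$$ Assume that either for each $\kappa<0$ the equation $\psi'(y)=\kappa\varphi$ has exactly one solution $y\in Y$, or $\dim Y<\infty$ and for each $\kappa<0$ this equation has at most two solutions in $Y$. Let $p\ge 1$ be a real number, let $\gamma\in L^\infty(T)\cap L^1(T)\setminus\{0\}$ with $\gamma\ge 0$, and let $r\in\mathbb R$ with $r>\inf_Y\psi$. Then for each $u\in L^p(T,Y)$ the function $\gamma\,\varphi(u)$ is integrable and the integral $\int_T\gamma(t)\psi(u(t))\,d\mu$ exists in $]-\infty,+\infty]$; and if $$V_{\gamma,r}=\Bigl\{u\in L^p(T,Y):\ \int_T\gamma(t)\psi(u(t))\,d\mu\le r\int_T\gamma(t)\,d\mu\Bigr\},$$ then $$\inf_{u\in V_{\gamma,r}}\int_T\gamma(t)\varphi(u(t))\,d\mu=\Bigl(\inf_{\psi^{-1}(r)}\varphi\Bigr)\int_T\gamma(t)\,d\mu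 ,$$ where both infima are finite and are taken over nonempty sets. -/

import Mathlib

open MeasureTheory Filter Topology

/-- A normed space is reflexive if the canonical isometric embedding into its bidual is onto. -/
def IsReflexiveSpace (Y : Type*) [NormedAddCommGroup Y] [NormedSpace ℝ Y] : Prop :=
  Function.Surjective (NormedSpace.inclusionInDoubleDual ℝ Y)

/-- Weak convergence of a sequence: convergence against every continuous linear functional. -/
def WeaklyConverges {Y : Type*} [NormedAddCommGroup Y] [NormedSpace ℝ Y]
    (x : ℕ → Y) (y : Y) : Prop :=
  ∀ l : StrongDual ℝ Y, Tendsto (fun n => l (x n)) atTop (𝓝 (l y))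

/-- Sequential weak lower semicontinuity of a real functional: `f y ≤ liminf f (x n)` whenever
`x n` converges weakly to `y`, in the form used by Mathlib for `LowerSemicontinuousAt`. -/
def SeqWeaklyLowerSemicontinuous {Y : Type*} [NormedAddCommGroup Y] [NormedSpace ℝ Y]
    (f : Y → ℝ) : Prop :=
  ∀ (x : ℕ → Y) (y : Y), WeaklyConverges x y → ∀ c < f y, ∀ᶠ n in atTop, c < f (x n)

/-- The set of all `u` in `L^p(T, Y)` such that `∫ γ ψ(u) dμ ≤ r ∫ γ dμ`. For `γ ψ(u)` with
integrable negative part the integral exists in `]-∞, +∞]`, and it is below a real number only if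
`γ ψ(u)` is integrable. -/
def integralSublevel {T : Type*} [MeasurableSpace T] {Y : Type*} [NormedAddCommGroup Y]
    (μ : Measure T) (p : ℝ) (γ : T → ℝ) (ψ : Y → ℝ) (r : ℝ) : Set (T → Y) :=
  {u | MemLp u (ENNReal.ofReal p) μ ∧ Integrable (fun t => γ t * ψ (u t)) μ ∧
    ∫ t, γ t * ψ (u t) ∂μ ≤ r * ∫ t, γ t ∂μ}

/-! The proof is Lagrange duality. For `lam > 0` the functional `φ + lam ψ` is weakly lower
semicontinuous and coercive, so it has a minimizer, which solves `ψ' = κ φ` with `κ = -1/lam`. The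
assumption on this equation makes the minimizer unique: directly in the first case, and in the
second because two minimizers would force a third critical point by a mountain pass argument
(`exists_critical_point_of_two_minimizers`). As `lam` runs over the positive reals, `ψ` at the
minimizer then varies continuously from high levels to low ones, so some minimizer `y` has `ψ y = r`
(`exists_isLagrangianMin_eq`).

This `y` minimizes `φ` on the level set. Integrating `φ y + lam r ≤ φ (u t) + lam ψ (u t)` against
`γ` gives the lower bound over the integral sublevel. For the upper bound, constants need not lie in
`L^p`; points `w` with `ψ w < r` and `φ w` close to `φ y` (`IsLagrangianMin.exists_lt`) are
truncated to sets of finite measure, the strict inequality absorbing the error. -/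

/-! ### Weak sequential compactness. -/

/-- A bounded sequence in a reflexive space has a weakly convergent subsequence. -/
theorem IsReflexiveSpace.exists_weaklyConverges_subseq {Y : Type*} [NormedAddCommGroup Y]
    [NormedSpace ℝ Y] (hY : IsReflexiveSpace Y) {x : ℕ → Y} {R : ℝ} (hx : ∀ n, ‖x n‖ ≤ R) :
    ∃ (y : Y) (θ : ℕ → ℕ), StrictMono θ ∧ WeaklyConverges (x ∘ θ) y := by
  -- The closed span is separable, so countably many norming functionals separate its points; this
  -- will make a weak-* compact set metrizable.
  set M : Submodule ℝ Y := (Submodule.span ℝ (Set.range x)).topologicalClosure with hM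
  have hxM : ∀ n, x n ∈ M := fun n =>
    Submodule.le_topologicalClosure _ (Submodule.subset_span ⟨n, rfl⟩)
  have hsep : TopologicalSpace.SeparableSpace M := by
    have h : TopologicalSpace.IsSeparable (M : Set Y) := by
      rw [hM, Submodule.topologicalClosure_coe]
      exact (Set.countable_range x).isSeparable.span.closure
    exact h.separableSpace
  set d := TopologicalSpace.denseSeq M
  choose l hl1 hl2 using fun k => exists_dual_vector'' ℝ (d k : Y)
  have hzero : ∀ z ∈ M, (∀ k, l k z = 0) → z = 0 := by
    intro z hz h
    by_contra hne
    have hpos : 0 < ‖z‖ := norm_pos_iff.2 hne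
    obtain ⟨k, hk⟩ := (TopologicalSpace.denseRange_denseSeq M).exists_dist_lt
      (⟨z, hz⟩ : M) (half_pos hpos)
    have hk' : ‖z - d k‖ < ‖z‖ / 2 := by simpa [dist_eq_norm] using hk
    have h1 : ‖(d k : Y)‖ ≤ ‖z - d k‖ := by
      have h2 := (l k).le_of_opNorm_le (hl1 k) (z - d k)
      rw [map_sub, h k, hl2 k] at h2
      simpa using h2
    have h3 : ‖z‖ ≤ ‖z - d k‖ + ‖(d k : Y)‖ := by
      simpa using norm_add_le (z - d k) (d k : Y)
    linarith
  -- By Hahn-Banach, membership in `M` is tested by functionals vanishing on `M`, which is a weak-*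
  -- closed condition on the bidual.
  have hmem : ∀ y : Y, (∀ f : StrongDual ℝ Y, (∀ z ∈ M, f z = 0) → f y = 0) → y ∈ M := by
    intro y h
    by_contra hy
    obtain ⟨f, u, hfu, huf⟩ := geometric_hahn_banach_point_closed (t := (M : Set Y))
      M.convex (Submodule.isClosed_topologicalClosure _) hy
    have hu : u < 0 := by simpa using huf 0 M.zero_mem
    have hf : ∀ z ∈ M, f z = 0 := by
      intro z hz
      by_contra hne
      have := huf ((u / f z) • z) (M.smul_mem _ hz)
      rw [map_smul, smul_eq_mul, div_mul_cancel₀ _ hne] at this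
      exact lt_irrefl _ this
    have := h f hf
    linarith
  set J : Y → WeakDual ℝ (StrongDual ℝ Y) := fun y =>
    StrongDual.toWeakDual (NormedSpace.inclusionInDoubleDual ℝ Y y) with hJ
  have hJs : ∀ F, ∃ y, J y = F := fun F => by
    obtain ⟨y, hy⟩ := hY (WeakDual.toStrongDual F)
    exact ⟨y, by rw [hJ]; simp [hy]⟩
  have hJa : ∀ y f, J y f = f y := fun y f => rfl
  set K : Set (WeakDual ℝ (StrongDual ℝ Y)) :=
    (WeakDual.toStrongDual ⁻¹' Metric.closedBall 0 R) ∩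
      ⋂ f ∈ {f : StrongDual ℝ Y | ∀ z ∈ M, f z = 0}, {F | F f = 0} with hK
  have hKc : IsCompact K := by
    refine (WeakDual.isCompact_closedBall 0 R).inter_right ?_
    refine isClosed_biInter fun f _ => ?_
    exact isClosed_eq (WeakDual.eval_continuous f) continuous_const
  have hKM : ∀ y, J y ∈ K → y ∈ M := by
    intro y hy
    refine hmem y fun f hf => ?_
    have := Set.mem_iInter₂.1 hy.2 f hf
    exact this
  have : CompactSpace K := isCompact_iff_compactSpace.mp hKc
  have hmet : TopologicalSpace.MetrizableSpace K := by
    refine Metric.PiNatEmbed.TopologicalSpace.MetrizableSpace.of_countable_separating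
      (fun k (F : K) => (F : WeakDual ℝ (StrongDual ℝ Y)) (l k))
      (fun k => (WeakDual.eval_continuous (l k)).comp continuous_subtype_val) ?_
    rintro ⟨F, hF⟩ ⟨G, hG⟩ hne
    obtain ⟨a, rfl⟩ := hJs F
    obtain ⟨b, rfl⟩ := hJs G
    by_contra hcon
    push Not at hcon
    have hab : a - b = 0 := hzero _ (M.sub_mem (hKM a hF) (hKM b hG)) fun k => by
      have := hcon k
      simp only [hJa] at this
      rw [map_sub, this, sub_self]
    exact hne (by simp [sub_eq_zero.1 hab])
  have hxK : ∀ n, J (x n) ∈ K := fun n => by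
    refine ⟨?_, Set.mem_iInter₂.2 fun f hf => hf _ (hxM n)⟩
    have h : NormedSpace.inclusionInDoubleDual ℝ Y (x n) ∈
        Metric.closedBall (0 : StrongDual ℝ (StrongDual ℝ Y)) R := by
      exact (dist_zero_right (NormedSpace.inclusionInDoubleDual ℝ Y (x n))).trans_le
        ((NormedSpace.double_dual_bound ℝ Y (x n)).trans (hx n))
    exact h
  let := TopologicalSpace.metrizableSpaceMetric K
  obtain ⟨F, θ, hθ, hF⟩ := CompactSpace.tendsto_subseq (fun n => (⟨J (x n), hxK n⟩ : K))
  obtain ⟨y, hy⟩ := hJs F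
  refine ⟨y, θ, hθ, fun f => ?_⟩
  have := ((WeakDual.eval_continuous f).comp continuous_subtype_val).continuousAt.tendsto.comp hF
  simp only [Function.comp_def, ← hy, hJa] at this
  exact this

/-! ### Minimizers of the Lagrangian: existence and stability. -/

/-- `y` is a global minimizer of the Lagrangian `φ + lam ψ`. -/
def IsLagrangianMin {Y : Type*} [NormedAddCommGroup Y] [NormedSpace ℝ Y]
    (φ : StrongDual ℝ Y) (ψ : Y → ℝ) (lam : ℝ) (y : Y) : Prop :=
  ∀ z, φ y + lam * ψ y ≤ φ z + lam * ψ z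

theorem exists_mul_norm_le_of_superlinear {Y : Type*} [NormedAddCommGroup Y] {ψ : Y → ℝ}
    (hlim : Tendsto (fun y : Y => ψ y / ‖y‖) (Bornology.cobounded Y) atTop) (K : ℝ) :
    ∃ R : ℝ, 0 < R ∧ ∀ y, R ≤ ‖y‖ → K * ‖y‖ ≤ ψ y := by
  obtain ⟨R, -, hR⟩ := hasBasis_cobounded_norm.mem_iff.1 (hlim.eventually_ge_atTop K)
  refine ⟨max R 1, by positivity, fun y hy => ?_⟩
  have h1 : K ≤ ψ y / ‖y‖ := hR ((le_max_left _ _).trans hy)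
  have h2 : 0 < ‖y‖ := zero_lt_one.trans_le ((le_max_right _ _).trans hy)
  exact (le_div_iff₀ h2).1 h1

section Lagrangian

variable {Y : Type*} [NormedAddCommGroup Y] [NormedSpace ℝ Y] {φ : StrongDual ℝ Y} {ψ : Y → ℝ}

/-- Slope `(‖φ‖ + 1) / δ` for `ψ` pays for `|φ y| ≤ ‖φ‖ ‖y‖` and leaves `‖y‖` over. The radius is
uniform in `lam ≥ δ`, as needed when `lam` varies. -/
theorem exists_norm_le_lagrangian (φ : StrongDual ℝ Y)
    (hlim : Tendsto (fun y : Y => ψ y / ‖y‖) (Bornology.cobounded Y) atTop)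
    {δ : ℝ} (hδ : 0 < δ) :
    ∃ R : ℝ, 0 < R ∧ ∀ lam, δ ≤ lam → ∀ y, R ≤ ‖y‖ → ‖y‖ ≤ φ y + lam * ψ y := by
  obtain ⟨R, hR, h⟩ := exists_mul_norm_le_of_superlinear hlim ((‖φ‖ + 1) / δ)
  refine ⟨R, hR, fun lam hlam y hy => ?_⟩
  have h1 := h y hy
  have h0 : 0 ≤ ψ y := le_trans (by positivity) h1
  have h2 : (‖φ‖ + 1) * ‖y‖ ≤ lam * ψ y := by
    calc (‖φ‖ + 1) * ‖y‖ = δ * ((‖φ‖ + 1) / δ * ‖y‖) := by field_simp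
      _ ≤ δ * ψ y := by gcongr
      _ ≤ lam * ψ y := by gcongr
  have h3 : -(‖φ‖ * ‖y‖) ≤ φ y := (abs_le.1 (φ.le_opNorm y)).1
  linarith

theorem SeqWeaklyLowerSemicontinuous.exists_forall_le (hY : IsReflexiveSpace Y) {f : Y → ℝ}
    (hf : SeqWeaklyLowerSemicontinuous f) {R : ℝ} (hR : ∀ y, R ≤ ‖y‖ → ‖y‖ ≤ f y) :
    ∃ y, ∀ z, f y ≤ f z := by
  have hbdd : BddBelow (Set.range f) := by
    by_contra hnb
    have : ∀ n : ℕ, ∃ x, f x < -n := fun n => by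
      by_contra! h
      exact hnb ⟨-n, by rintro _ ⟨x, rfl⟩; exact h x⟩
    choose x hx using this
    have hxR : ∀ n, ‖x n‖ ≤ R := fun n => by
      by_contra! h
      have h1 := hR _ h.le
      have h2 := norm_nonneg (x n)
      have h3 := hx n
      have h4 : (0 : ℝ) ≤ n := n.cast_nonneg
      linarith
    obtain ⟨y, θ, hθ, hy⟩ := hY.exists_weaklyConverges_subseq hxR
    obtain ⟨n, hn1, hn2⟩ := ((hf _ _ hy (f y - 1) (by linarith)).and
      (eventually_ge_atTop ⌈1 - f y⌉₊)).exists
    have h1 : 1 - f y ≤ (θ n : ℝ) :=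
      (Nat.le_ceil _).trans (by exact_mod_cast hn2.trans (hθ.id_le n))
    have h2 := hx (θ n)
    simp only [Function.comp_apply] at hn1
    linarith
  obtain ⟨a, ha, hlim, hmem⟩ := exists_seq_tendsto_sInf (Set.range_nonempty f) hbdd
  choose x hx using hmem
  obtain ⟨B, hB⟩ := hlim.bddAbove_range
  have hxR : ∀ n, ‖x n‖ ≤ max R B := fun n => by
    by_contra! h
    have h1 := hR _ ((le_max_left _ _).trans h.le)
    have h2 : a n ≤ B := hB ⟨n, rfl⟩
    have h3 := (le_max_right R B).trans_lt h
    rw [hx n] at h1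
    linarith
  obtain ⟨y, θ, hθ, hy⟩ := hY.exists_weaklyConverges_subseq hxR
  refine ⟨y, fun z => ?_⟩
  refine le_trans ?_ (csInf_le hbdd ⟨z, rfl⟩)
  refine le_of_forall_lt fun c hc => ?_
  obtain ⟨c', hc', hc''⟩ := exists_between hc
  refine hc'.trans_le (ge_of_tendsto (hlim.comp hθ.tendsto_atTop) ?_)
  filter_upwards [hf _ _ hy c' hc''] with n hn
  rw [Function.comp_apply, hx] at hn
  exact hn.le

theorem SeqWeaklyLowerSemicontinuous.add_mul {f : Y → ℝ} (hf : SeqWeaklyLowerSemicontinuous f)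
    (φ : StrongDual ℝ Y) {lam : ℝ} (hlam : 0 < lam) :
    SeqWeaklyLowerSemicontinuous fun y => φ y + lam * f y := by
  intro x y hxy c hc
  set ε := (φ y + lam * f y - c) / 2 with hε
  have hε0 : 0 < ε := by rw [hε]; linarith
  have h1 := hf x y hxy (f y - ε / lam) (by have := div_pos hε0 hlam; linarith)
  have h2 := (hxy φ).eventually (lt_mem_nhds (show φ y - ε < φ y by linarith))
  filter_upwards [h1, h2] with n hn1 hn2
  have h3 : lam * (f y - ε / lam) < lam * f (x n) := by gcongr
  have h4 : lam * (f y - ε / lam) = lam * f y - ε := by field_simp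
  linarith

theorem exists_isLagrangianMin (hY : IsReflexiveSpace Y) (φ : StrongDual ℝ Y)
    (hψ : SeqWeaklyLowerSemicontinuous ψ)
    (hlim : Tendsto (fun y : Y => ψ y / ‖y‖) (Bornology.cobounded Y) atTop)
    {lam : ℝ} (hlam : 0 < lam) : ∃ y, IsLagrangianMin φ ψ lam y := by
  obtain ⟨R, -, hR⟩ := exists_norm_le_lagrangian φ hlim hlam
  exact (hψ.add_mul φ hlam).exists_forall_le hY (hR lam le_rfl)

theorem SeqWeaklyLowerSemicontinuous.bddBelow (hY : IsReflexiveSpace Y)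
    (hψ : SeqWeaklyLowerSemicontinuous ψ)
    (hlim : Tendsto (fun y : Y => ψ y / ‖y‖) (Bornology.cobounded Y) atTop) :
    ∃ C, ∀ y, C ≤ ψ y := by
  obtain ⟨R, -, hR⟩ := exists_mul_norm_le_of_superlinear hlim 1
  obtain ⟨y, hy⟩ := hψ.exists_forall_le hY (R := R) (fun y hy => by simpa using hR y hy)
  exact ⟨ψ y, hy⟩

/-- Minimizers of `φ + lam ψ` subconverge to a minimizer as `lam` converges to a positive limit,
with convergence of the values of `ψ`. -/
theorem exists_isLagrangianMin_of_tendsto (hY : IsReflexiveSpace Y)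
    (hψ : SeqWeaklyLowerSemicontinuous ψ)
    (hlim : Tendsto (fun y : Y => ψ y / ‖y‖) (Bornology.cobounded Y) atTop)
    {lam : ℕ → ℝ} {L : ℝ} (hL : 0 < L) (hlam : Tendsto lam atTop (𝓝 L)) {y : ℕ → Y}
    (hy : ∀ n, IsLagrangianMin φ ψ (lam n) (y n)) :
    ∃ y₀, IsLagrangianMin φ ψ L y₀ ∧ (∀ r, (∀ n, r ≤ ψ (y n)) → r ≤ ψ y₀) ∧
      ∀ r, (∀ n, ψ (y n) ≤ r) → ψ y₀ ≤ r := by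
  obtain ⟨R, -, hR⟩ := exists_norm_le_lagrangian φ hlim (half_pos hL)
  obtain ⟨N, hN⟩ := eventually_atTop.1 (hlam.eventually (le_mem_nhds (half_lt_self hL)))
  obtain ⟨B, hB⟩ := (hlam.mul_const (ψ 0)).bddAbove_range
  have hbd : ∀ n, ‖y (n + N)‖ ≤ max R B := fun n => by
    by_contra! h
    have h1 := hR _ (hN (n + N) (by omega)) _ ((le_max_left _ _).trans h.le)
    have h2 := hy (n + N) 0
    have h3 : lam (n + N) * ψ 0 ≤ B := hB ⟨n + N, rfl⟩
    have h4 := (le_max_right R B).trans_lt h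
    rw [map_zero, zero_add] at h2
    linarith
  obtain ⟨y₀, θ, hθ, hy₀⟩ := hY.exists_weaklyConverges_subseq hbd
  have hθt : Tendsto (fun n => θ n + N) atTop atTop :=
    (tendsto_add_atTop_nat N).comp hθ.tendsto_atTop
  have hl := hlam.comp hθt
  have hφ := hy₀ φ
  simp only [Function.comp_def] at hl hφ
  refine ⟨y₀, fun z => ?_, fun r hr => ?_, fun r hr => ?_⟩
  · have key : ∀ c < ψ y₀, φ y₀ + L * c ≤ φ z + L * ψ z := by
      intro c hc
      refine le_of_tendsto_of_tendsto (hφ.add (hl.mul_const c))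
        (tendsto_const_nhds.add (hl.mul_const (ψ z))) ?_
      filter_upwards [hψ _ _ hy₀ c hc] with n hn
      refine le_trans ?_ (hy (θ n + N) z)
      have h1 : 0 ≤ lam (θ n + N) := (half_pos hL).le.trans (hN (θ n + N) (by omega))
      simp only [Function.comp_apply] at hn
      gcongr
    refine le_of_forall_lt fun c hc => ?_
    obtain ⟨c', h1, h2⟩ := exists_between hc
    have h3 := key ((c' - φ y₀) / L) ((div_lt_iff₀ hL).2 (by linarith))
    rw [mul_div_cancel₀ _ hL.ne'] at h3
    linarith
  -- Testing the minimality of `y n` against `y₀` gives the upper bound on the limit of `ψ (y n)`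
  -- that weak lower semicontinuity cannot give.
  · have h : L * (r - ψ y₀) ≤ φ y₀ - φ y₀ := by
      refine le_of_tendsto_of_tendsto' (hl.mul_const (r - ψ y₀)) (tendsto_const_nhds.sub hφ)
        fun n => ?_
      have h1 : 0 ≤ lam (θ n + N) := (half_pos hL).le.trans (hN (θ n + N) (by omega))
      have h2 := hy (θ n + N) y₀
      have h3 := mul_le_mul_of_nonneg_left (hr (θ n + N)) h1
      linarith
    have : r - ψ y₀ ≤ 0 := by
      rw [sub_self] at h
      exact nonpos_of_mul_nonpos_right h hL
    linarith
  · by_contra! h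
    obtain ⟨n, hn⟩ := (hψ _ _ hy₀ r h).exists
    exact absurd (hr (θ n + N)) (not_le.2 hn)

end Lagrangian

/-! ### A finite-dimensional mountain pass theorem. -/

section ThirdCriticalPoint

variable {Y : Type*} [NormedAddCommGroup Y] [NormedSpace ℝ Y] [FiniteDimensional ℝ Y]

/-- A gradient-like continuous vector field on a finite-dimensional space. -/
noncomputable def gradientField (J : Y → ℝ) (x : Y) : Y :=
  ∑ i, fderiv ℝ J x (Module.finBasis ℝ Y i) • Module.finBasis ℝ Y i

theorem continuous_gradientField {J : Y → ℝ} (hJ : ContDiff ℝ 1 J) :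
    Continuous (gradientField J) := by
  have := hJ.continuous_fderiv one_ne_zero
  unfold gradientField
  fun_prop

theorem gradientField_eq_zero {J : Y → ℝ} {x : Y} (hx : fderiv ℝ J x = 0) :
    gradientField J x = 0 := by
  simp [gradientField, hx]

theorem fderiv_gradientField_pos {J : Y → ℝ} {x : Y} (hx : fderiv ℝ J x ≠ 0) :
    0 < fderiv ℝ J x (gradientField J x) := by
  have h : fderiv ℝ J x (gradientField J x) =
      ∑ i, fderiv ℝ J x (Module.finBasis ℝ Y i) ^ 2 := by
    simp [gradientField, map_sum, sq]
  rw [h]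
  refine lt_of_le_of_ne (Finset.sum_nonneg fun i _ => sq_nonneg _) fun h0 => hx ?_
  have h1 := (Finset.sum_eq_zero_iff_of_nonneg fun i _ => sq_nonneg _).1 h0.symm
  have h2 : (fderiv ℝ J x : Y →ₗ[ℝ] ℝ) = 0 :=
    (Module.finBasis ℝ Y).ext fun i => by simpa using h1 i (Finset.mem_univ i)
  ext y
  exact LinearMap.congr_fun h2 y

/-- Near a compact set of regular points, small steps along the gradient-like field strictly
decrease the function. -/
theorem exists_step_lt {J : Y → ℝ} (hJ : ContDiff ℝ 1 J) {L : Set Y} (hL : IsCompact L)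
    (hreg : ∀ x ∈ L, fderiv ℝ J x ≠ 0) :
    ∃ (s₀ : ℝ) (U : Set Y), 0 < s₀ ∧ IsOpen U ∧ L ⊆ U ∧
      ∀ x ∈ U, ∀ s, 0 < s → s ≤ s₀ → J (x - s • gradientField J x) < J x := by
  have hv := continuous_gradientField hJ
  have hd := hJ.continuous_fderiv one_ne_zero
  set g : ℝ × Y → ℝ := fun q =>
    fderiv ℝ J (q.2 - q.1 • gradientField J q.2) (gradientField J q.2) with hg
  have hgc : Continuous g := by rw [hg]; fun_prop
  obtain ⟨I, U, hI, hU, h0I, hLU, hIU⟩ := generalized_tube_lemma (isCompact_singleton (x := (0 : ℝ)))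
    hL (isOpen_lt continuous_const hgc : IsOpen {q | 0 < g q}) (by
      rintro ⟨s, x⟩ ⟨hs, hx⟩
      obtain rfl : s = 0 := hs
      simpa [hg] using fderiv_gradientField_pos (hreg x hx))
  obtain ⟨ε, hε, hball⟩ := Metric.isOpen_iff.1 hI 0 (h0I rfl)
  refine ⟨ε / 2, U, half_pos hε, hU, hLU, fun x hx s hs hs' => ?_⟩
  have hderiv : ∀ τ, HasDerivAt (fun τ : ℝ => J (x - τ • gradientField J x)) (-g (τ, x)) τ := by
    intro τ
    have h1 : HasDerivAt (fun τ : ℝ => x - τ • gradientField J x) (-gradientField J x) τ := by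
      simpa using ((hasDerivAt_id τ).smul_const (gradientField J x)).const_sub x
    have h2 := ((hJ.differentiable one_ne_zero) (x - τ • gradientField J x)).hasFDerivAt
    have h3 := h2.comp_hasDerivAt τ h1
    rw [map_neg] at h3
    exact h3
  have hanti : StrictAntiOn (fun τ : ℝ => J (x - τ • gradientField J x)) (Set.Icc 0 s) := by
    refine strictAntiOn_of_deriv_neg (convex_Icc 0 s)
      (fun τ _ => (hderiv τ).continuousAt.continuousWithinAt) fun τ hτ => ?_
    rw [interior_Icc] at hτ
    rw [(hderiv τ).deriv, neg_lt_zero]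
    refine @hIU (τ, x) ⟨hball ?_, hx⟩
    rw [mem_ball_zero_iff, Real.norm_eq_abs, abs_of_pos hτ.1]
    linarith [hτ.2]
  simpa using hanti (Set.left_mem_Icc.2 hs.le) (Set.right_mem_Icc.2 hs.le) hs

/-- A `C¹` function with compact sublevels on a finite-dimensional space and two distinct global
minimizers has a third critical point. -/
theorem exists_critical_point_of_two_minimizers {J : Y → ℝ} (hJ : ContDiff ℝ 1 J)
    (hcomp : ∀ c, IsCompact {y | J y ≤ c}) {a b : Y} (hab : a ≠ b)
    (ha : ∀ z, J a ≤ J z) (hb : ∀ z, J b ≤ J z) :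
    ∃ y, y ≠ a ∧ y ≠ b ∧ fderiv ℝ J y = 0 := by
  by_contra! hno
  have hJc := hJ.continuous
  have crit : ∀ y, (∀ z, J y ≤ J z) → fderiv ℝ J y = 0 := fun y hy =>
    IsLocalMin.fderiv_eq_zero (Eventually.of_forall hy)
  have hlt : ∀ z, z ≠ a → z ≠ b → J a < J z := fun z hza hzb => by
    by_contra! h
    exact hno z hza hzb (crit z fun w => h.trans (ha w))
  have hJab : J a = J b := le_antisymm (ha b) (hb a)
  have hd : 0 < dist b a := dist_pos.2 hab.symm
  -- The ridge: the sphere of half radius about `a` misses both minimizers, and every connected set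
  -- joining them crosses it.
  obtain ⟨σ, hσ, hsph⟩ : ∃ σ, J a < σ ∧ ∀ z, dist z a = dist b a / 2 → σ ≤ J z := by
    rcases (Metric.sphere a (dist b a / 2)).eq_empty_or_nonempty with he | hne
    · refine ⟨J a + 1, by linarith, fun z hz => ?_⟩
      exact absurd (Metric.mem_sphere.2 hz) (by simp [he])
    · obtain ⟨z₀, hz₀, hmin⟩ := (isCompact_sphere a (dist b a / 2)).exists_isMinOn hne
        hJc.continuousOn
      refine ⟨J z₀, hlt z₀ ?_ ?_, fun z hz => hmin (Metric.mem_sphere.2 hz)⟩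
      · rintro rfl
        rw [Metric.mem_sphere, dist_self] at hz₀
        linarith
      · rintro rfl
        rw [Metric.mem_sphere] at hz₀
        linarith
  -- The minimax runs over preconnected sets instead of paths; continuous images preserve them.
  set C : Set ℝ := {c | ∃ S : Set Y, IsPreconnected S ∧ a ∈ S ∧ b ∈ S ∧ ∀ x ∈ S, J x ≤ c} with hC
  have hCne : C.Nonempty := by
    obtain ⟨c, hc⟩ := ((isCompact_closedBall a (dist b a)).image hJc).bddAbove
    exact ⟨c, Metric.closedBall a (dist b a), (convex_closedBall _ _).isPreconnected,
      Metric.mem_closedBall_self hd.le, Metric.mem_closedBall.2 le_rfl,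
      fun x hx => hc ⟨x, hx, rfl⟩⟩
  have hClb : ∀ c ∈ C, σ ≤ c := by
    rintro c ⟨S, hS, haS, hbS, hSc⟩
    obtain ⟨z, hzS, hz⟩ := hS.intermediate_value haS hbS
      (f := fun x => dist x a) (by fun_prop)
      (show dist b a / 2 ∈ Set.Icc (dist a a) (dist b a) by
        rw [dist_self]; constructor <;> linarith)
    exact (hsph z hz).trans (hSc z hzS)
  have hCbdd : BddBelow C := ⟨σ, hClb⟩
  set cs := sInf C with hcs
  have hmcs : J a < cs := hσ.trans_le (le_csInf hCne hClb)
  have hLc : IsCompact {x | J x = cs} :=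
    (hcomp cs).of_isClosed_subset (isClosed_eq hJc continuous_const) fun x hx => le_of_eq hx
  obtain ⟨s₀, U, hs₀, hU, hLU, hstep⟩ := exists_step_lt hJ hLc (by
    intro x (hx : J x = cs)
    refine hno x ?_ ?_
    · rintro rfl; exact hmcs.ne hx
    · rintro rfl; exact (hJab ▸ hmcs).ne hx)
  obtain ⟨f, hf0, hf1, hf01⟩ := exists_continuous_zero_one_of_isClosed hU.isClosed_compl
    hLc.isClosed (Set.disjoint_left.2 fun x hx hx' => hx (hLU hx'))
  -- The deformation takes the full step on the level `cs`, no step outside `U`, and never raises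
  -- `J`.
  set η : Y → Y := fun x => x - (s₀ * f x) • gradientField J x with hη
  have hηc : Continuous η := by
    have := continuous_gradientField hJ
    rw [hη]
    fun_prop
  have hηle : ∀ x, J (η x) ≤ J x := by
    intro x
    rcases (hf01 x).1.eq_or_lt with h | h
    · simp [hη, ← h]
    · have hxU : x ∈ U := by
        by_contra hx
        exact h.ne' (hf0 hx)
      exact (hstep x hxU _ (mul_pos hs₀ h) (mul_le_of_le_one_right hs₀.le (hf01 x).2)).le
  have hηlt : ∀ x, J x ≤ cs → J (η x) < cs := by
    intro x hx
    rcases hx.lt_or_eq with h | h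
    · exact (hηle x).trans_lt h
    · have hfx : f x = 1 := hf1 h
      have := hstep x (hLU h) s₀ hs₀ le_rfl
      simp only [hη, hfx, mul_one]
      exact this.trans_eq h
  -- Compactness makes the descent uniform: `η` sends the sublevel `cs`, and even a slightly higher
  -- one, below some `M < cs`.
  obtain ⟨x₀, hx₀, hmax⟩ := (hcomp cs).exists_isMaxOn ⟨a, hmcs.le⟩
    (hJc.comp hηc).continuousOn
  obtain ⟨M, hM1, hM2⟩ := exists_between (hηlt x₀ hx₀)
  obtain ⟨d, hd1, hd2⟩ : ∃ d, cs < d ∧ ∀ x, J x < d → J (η x) < M := by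
    have hT : IsCompact ({x | J x ≤ cs + 1} ∩ {x | M ≤ J (η x)}) :=
      (hcomp _).inter_right (isClosed_le continuous_const (hJc.comp hηc))
    rcases Set.eq_empty_or_nonempty ({x | J x ≤ cs + 1} ∩ {x | M ≤ J (η x)}) with he | hne
    · refine ⟨cs + 1, by linarith, fun x hx => ?_⟩
      by_contra! h
      exact Set.notMem_empty x (he ▸ ⟨hx.le, h⟩)
    · obtain ⟨t, ht, hmin⟩ := hT.exists_isMinOn hne hJc.continuousOn
      refine ⟨J t, ?_, fun x hx => ?_⟩
      · by_contra! h
        exact absurd (ht.2.trans (hmax h)) (not_le.2 hM1)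
      · by_contra! h
        exact absurd (hmin ⟨hx.le.trans ht.1, h⟩) (not_le.2 hx)
  obtain ⟨c, ⟨S, hS, haS, hbS, hSc⟩, hcd⟩ := exists_lt_of_csInf_lt hCne hd1
  have hfix : ∀ y, (∀ z, J y ≤ J z) → η y = y := fun y hy => by
    simp [hη, gradientField_eq_zero (crit y hy)]
  have : M ∈ C := ⟨η '' S, hS.image η hηc.continuousOn, ⟨a, haS, hfix a ha⟩,
    ⟨b, hbS, hfix b hb⟩, by
      rintro _ ⟨x, hx, rfl⟩
      exact (hd2 x ((hSc x hx).trans_lt hcd)).le⟩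
  exact absurd (csInf_le hCbdd this) (not_le.2 hM2)

end ThirdCriticalPoint

/-! ### Uniqueness of minimizers and choice of the multiplier. -/

section Multiplier

variable {Y : Type*} [NormedAddCommGroup Y] [NormedSpace ℝ Y] {φ : StrongDual ℝ Y} {ψ : Y → ℝ}

theorem fderiv_eq_of_fderiv_lagrangian_eq_zero {lam : ℝ} {y : Y} (hlam : 0 < lam)
    (hψ : Differentiable ℝ ψ) (hy : fderiv ℝ (fun y => φ y + lam * ψ y) y = 0) :
    fderiv ℝ ψ y = (-lam⁻¹) • φ := by
  have h1 : HasFDerivAt (fun y => φ y + lam * ψ y) (φ + lam • fderiv ℝ ψ y) y :=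
    φ.hasFDerivAt.add ((hψ y).hasFDerivAt.const_mul lam)
  have h2 : φ + lam • fderiv ℝ ψ y = 0 := h1.fderiv.symm.trans hy
  refine ContinuousLinearMap.ext fun z => ?_
  have h3 : φ z + lam * fderiv ℝ ψ y z = 0 := DFunLike.congr_fun h2 z
  change fderiv ℝ ψ y z = -lam⁻¹ * φ z
  field_simp
  linarith

theorem IsLagrangianMin.fderiv_eq {lam : ℝ} {y : Y} (hy : IsLagrangianMin φ ψ lam y)
    (hlam : 0 < lam) (hψ : Differentiable ℝ ψ) : fderiv ℝ ψ y = (-lam⁻¹) • φ :=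
  fderiv_eq_of_fderiv_lagrangian_eq_zero hlam hψ
    (IsLocalMin.fderiv_eq_zero (f := fun y => φ y + lam * ψ y) (Eventually.of_forall hy))

theorem IsLagrangianMin.unique (hψ : ContDiff ℝ 1 ψ)
    (hlim : Tendsto (fun y : Y => ψ y / ‖y‖) (Bornology.cobounded Y) atTop)
    (hsol : (∀ κ : ℝ, κ < 0 → ∃! y : Y, fderiv ℝ ψ y = κ • φ) ∨
      (FiniteDimensional ℝ Y ∧
        ∀ κ : ℝ, κ < 0 → {y : Y | fderiv ℝ ψ y = κ • φ}.encard ≤ 2))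
    {lam : ℝ} (hlam : 0 < lam) {a b : Y} (ha : IsLagrangianMin φ ψ lam a)
    (hb : IsLagrangianMin φ ψ lam b) : a = b := by
  have hd := hψ.differentiable one_ne_zero
  have hκ : -lam⁻¹ < 0 := neg_lt_zero.2 (inv_pos.2 hlam)
  rcases hsol with h | ⟨hfin, h⟩
  · exact (h _ hκ).unique (ha.fderiv_eq hlam hd) (hb.fderiv_eq hlam hd)
  · by_contra hab
    have hJ : ContDiff ℝ 1 fun y => φ y + lam * ψ y :=
      φ.contDiff.add (contDiff_const.mul hψ)
    obtain ⟨R, -, hR⟩ := exists_norm_le_lagrangian φ hlim hlam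
    have hcomp : ∀ c, IsCompact {y | φ y + lam * ψ y ≤ c} := fun c => by
      refine (isCompact_closedBall (0 : Y) (max R c)).of_isClosed_subset
        (isClosed_le hJ.continuous continuous_const) fun y (hy : _ ≤ c) => ?_
      rw [mem_closedBall_zero_iff]
      by_contra! hlt
      have h1 := hR lam le_rfl y ((le_max_left _ _).trans hlt.le)
      have h2 := (le_max_right R c).trans_lt hlt
      linarith
    obtain ⟨y, hya, hyb, hy⟩ := exists_critical_point_of_two_minimizers hJ hcomp hab ha hb
    have hsub : ({y, a, b} : Set Y) ⊆ {y : Y | fderiv ℝ ψ y = (-lam⁻¹) • φ} := by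
      rintro z (rfl | rfl | rfl)
      · exact fderiv_eq_of_fderiv_lagrangian_eq_zero hlam hd hy
      · exact ha.fderiv_eq hlam hd
      · exact hb.fderiv_eq hlam hd
    have h3 : ({y, a, b} : Set Y).encard = 3 := Set.encard_eq_three.2 ⟨y, a, b, hya, hyb, hab, rfl⟩
    have := (Set.encard_le_encard hsub).trans (h _ hκ)
    rw [h3] at this
    exact absurd this (by norm_num)

/-- Small `lam`: if all minimizers stayed below level `r` they would be bounded, and letting `lam →
0` would bound the nonzero linear `φ` from below. -/
theorem exists_isLagrangianMin_ge (hY : IsReflexiveSpace Y) (hφ : φ ≠ 0)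
    (hψ : SeqWeaklyLowerSemicontinuous ψ)
    (hlim : Tendsto (fun y : Y => ψ y / ‖y‖) (Bornology.cobounded Y) atTop) (r : ℝ) :
    ∃ lam, 0 < lam ∧ ∃ y, IsLagrangianMin φ ψ lam y ∧ r ≤ ψ y := by
  by_contra! hcon
  obtain ⟨R, -, hR⟩ := exists_mul_norm_le_of_superlinear hlim 1
  obtain ⟨C, hC⟩ := hψ.bddBelow hY hlim
  have hbd : ∀ y, ψ y < r → -(‖φ‖ * max R r) ≤ φ y := fun y hy => by
    have h1 : ‖y‖ ≤ max R r := by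
      by_contra! hlt
      have h1 := hR y ((le_max_left _ _).trans hlt.le)
      have h2 := (le_max_right R r).trans_lt hlt
      linarith
    have h2 := (abs_le.1 (φ.le_opNorm_of_le h1)).1
    exact h2
  have hall : ∀ y, -(‖φ‖ * max R r) ≤ φ y := fun y => by
    have h : ∀ lam : ℝ, 0 < lam → -(‖φ‖ * max R r) ≤ φ y + lam * (ψ y - C) := fun lam hlam => by
      obtain ⟨z, hz⟩ := exists_isLagrangianMin hY φ hψ hlim hlam
      have h1 := hbd z (hcon lam hlam z hz)
      have h2 := hz y
      have h3 := mul_le_mul_of_nonneg_left (hC z) hlam.le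
      linarith
    have hc : Tendsto (fun lam : ℝ => φ y + lam * (ψ y - C)) (𝓝[>] 0) (𝓝 (φ y)) := by
      have : Continuous fun lam : ℝ => φ y + lam * (ψ y - C) := by fun_prop
      simpa using (this.tendsto 0).mono_left nhdsWithin_le_nhds
    exact ge_of_tendsto hc (eventually_mem_nhdsWithin.mono h)
  refine hφ (ContinuousLinearMap.ext fun y => ?_)
  by_contra hne
  have h1 := hall (((-(‖φ‖ * max R r) - 1) / φ y) • y)
  change φ y ≠ 0 at hne
  rw [map_smul, smul_eq_mul, div_mul_cancel₀ _ hne] at h1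
  linarith

/-- Large `lam`: minimizers above level `r`, compared with `z` and with the minimum at `lam = 1`,
would bound `lam * (r - ψ z)`. -/
theorem exists_isLagrangianMin_le (hY : IsReflexiveSpace Y)
    (hψ : SeqWeaklyLowerSemicontinuous ψ)
    (hlim : Tendsto (fun y : Y => ψ y / ‖y‖) (Bornology.cobounded Y) atTop) {r : ℝ} {z : Y}
    (hz : ψ z < r) :
    ∃ lam, 0 < lam ∧ ∃ y, IsLagrangianMin φ ψ lam y ∧ ψ y ≤ r := by
  by_contra! hcon
  obtain ⟨w, hw⟩ := exists_isLagrangianMin hY φ hψ hlim one_pos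
  set m := φ w + 1 * ψ w
  have h : ∀ lam : ℝ, 1 ≤ lam → lam * (r - ψ z) ≤ φ z + r - m := fun lam hlam => by
    have hlam0 : 0 < lam := zero_lt_one.trans_le hlam
    obtain ⟨y, hy⟩ := exists_isLagrangianMin hY φ hψ hlim hlam0
    have h1 := hcon lam hlam0 y hy
    have h2 := hw y
    have h3 := hy z
    have h4 := mul_le_mul_of_nonneg_left h1.le (sub_nonneg.2 hlam)
    linarith
  have hpos : 0 < r - ψ z := sub_pos.2 hz
  have h1 := h (max 1 ((φ z + r - m + 1) / (r - ψ z))) (le_max_left _ _)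
  have h2 := mul_le_mul_of_nonneg_right
    (le_max_right 1 ((φ z + r - m + 1) / (r - ψ z))) hpos.le
  rw [div_mul_cancel₀ _ hpos.ne'] at h2
  linarith

/-- If the Lagrangians have unique minimizers, every level `r > inf ψ` is attained at a minimizer
of some Lagrangian. -/
theorem exists_isLagrangianMin_eq (hY : IsReflexiveSpace Y) (hφ : φ ≠ 0)
    (hψ : SeqWeaklyLowerSemicontinuous ψ)
    (hlim : Tendsto (fun y : Y => ψ y / ‖y‖) (Bornology.cobounded Y) atTop)
    (huniq : ∀ lam, 0 < lam → ∀ a b, IsLagrangianMin φ ψ lam a → IsLagrangianMin φ ψ lam b → a = b)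
    {r : ℝ} {z : Y} (hz : ψ z < r) :
    ∃ lam, 0 < lam ∧ ∃ y, IsLagrangianMin φ ψ lam y ∧ ψ y = r := by
  -- With `lam = exp t`, two closed sets cover the connected line, so they meet; uniqueness merges
  -- the two minimizers found there.
  set A : Set ℝ := {t | ∃ y, IsLagrangianMin φ ψ (Real.exp t) y ∧ r ≤ ψ y} with hA
  set B : Set ℝ := {t | ∃ y, IsLagrangianMin φ ψ (Real.exp t) y ∧ ψ y ≤ r} with hB
  have hAc : IsClosed A := by
    refine IsSeqClosed.isClosed fun t t₀ ht htt => ?_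
    choose y hy hyr using ht
    obtain ⟨y₀, h1, h2, -⟩ := exists_isLagrangianMin_of_tendsto hY hψ hlim (Real.exp_pos t₀)
      ((Real.continuous_exp.tendsto t₀).comp htt) hy
    exact ⟨y₀, h1, h2 r hyr⟩
  have hBc : IsClosed B := by
    refine IsSeqClosed.isClosed fun t t₀ ht htt => ?_
    choose y hy hyr using ht
    obtain ⟨y₀, h1, -, h2⟩ := exists_isLagrangianMin_of_tendsto hY hψ hlim (Real.exp_pos t₀)
      ((Real.continuous_exp.tendsto t₀).comp htt) hy
    exact ⟨y₀, h1, h2 r hyr⟩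
  have hcov : Set.univ ⊆ A ∪ B := fun t _ => by
    obtain ⟨y, hy⟩ := exists_isLagrangianMin hY φ hψ hlim (Real.exp_pos t)
    exact (le_total r (ψ y)).imp (fun h => ⟨y, hy, h⟩) fun h => ⟨y, hy, h⟩
  obtain ⟨lam₁, hlam₁, h₁⟩ := exists_isLagrangianMin_ge hY hφ hψ hlim r
  obtain ⟨lam₂, hlam₂, h₂⟩ := exists_isLagrangianMin_le (φ := φ) hY hψ hlim hz
  obtain ⟨t, -, ⟨y, hy, hyr⟩, ⟨y', hy', hyr'⟩⟩ :=
    isPreconnected_closed_iff.1 (isPreconnected_univ (α := ℝ)) A B hAc hBc hcov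
      ⟨Real.log lam₁, trivial, by
        change ∃ y, IsLagrangianMin φ ψ (Real.exp (Real.log lam₁)) y ∧ r ≤ ψ y
        rwa [Real.exp_log hlam₁]⟩
      ⟨Real.log lam₂, trivial, by
        change ∃ y, IsLagrangianMin φ ψ (Real.exp (Real.log lam₂)) y ∧ ψ y ≤ r
        rwa [Real.exp_log hlam₂]⟩
  obtain rfl := huniq _ (Real.exp_pos t) y y' hy hy'
  exact ⟨_, Real.exp_pos t, y, hy, le_antisymm hyr' hyr⟩

/-- Near a Lagrangian minimizer there are points with strictly smaller `ψ` and almost the same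
value of `φ`. -/
theorem IsLagrangianMin.exists_lt {lam : ℝ} {y : Y} (hy : IsLagrangianMin φ ψ lam y)
    (hlam : 0 < lam) (hφ : φ ≠ 0) (hψ : Differentiable ℝ ψ) {ε : ℝ} (hε : 0 < ε) :
    ∃ z, ψ z < ψ y ∧ φ z < φ y + ε := by
  -- Otherwise `y` would be a local minimizer of `ψ`, although `ψ' y = -φ / lam` is nonzero.
  by_contra! hcon
  have hloc : IsLocalMin ψ y := by
    have := φ.continuous.continuousAt.eventually (gt_mem_nhds (show φ y < φ y + ε by linarith))
    filter_upwards [this] with z hz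
    by_contra! hlt
    exact absurd (hcon z hlt) (not_le.2 hz)
  have h1 := hy.fderiv_eq hlam hψ
  rw [hloc.fderiv_eq_zero] at h1
  exact (smul_ne_zero (neg_ne_zero.2 (inv_ne_zero hlam.ne')) hφ) h1.symm

end Multiplier

/-! ### Weighted integrals and truncated constants. -/

section Integrals

variable {T : Type*} [MeasurableSpace T] {μ : Measure T} {Y : Type*} [NormedAddCommGroup Y]
  {γ : T → ℝ}

theorem MeasureTheory.MemLp.integrable_mul_norm_of_memLp_top (hγ_top : MemLp γ ⊤ μ)
    (hγ : Integrable γ μ) {p : ℝ} (hp : 1 ≤ p) {u : T → Y} (hu : MemLp u (ENNReal.ofReal p) μ) :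
    Integrable (fun t => γ t * ‖u t‖) μ := by
  have hp0 : 0 < p := zero_lt_one.trans_le hp
  have h1 : Integrable (fun t => ‖u t‖ ^ p) μ := by
    have := hu.integrable_norm_rpow (ENNReal.ofReal_pos.2 hp0).ne' ENNReal.ofReal_ne_top
    rwa [ENNReal.toReal_ofReal hp0.le] at this
  have h2 : Integrable (fun t => γ t * ‖u t‖ ^ p) μ :=
    memLp_one_iff_integrable.1 ((memLp_one_iff_integrable.2 h1).mul hγ_top)
  refine (hγ.norm.add h2.norm).mono' (hγ.aestronglyMeasurable.mul hu.aestronglyMeasurable.norm)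
    (Eventually.of_forall fun t => ?_)
  -- The `1` is handled by `γ ∈ L¹`, the power by `γ ∈ L^∞`.
  have h3 : ‖u t‖ ≤ 1 + ‖u t‖ ^ p := by
    rcases le_total ‖u t‖ 1 with h | h
    · have := Real.rpow_nonneg (norm_nonneg (u t)) p
      linarith
    · have := Real.self_le_rpow_of_one_le h hp
      linarith
  have h4 : 0 ≤ ‖u t‖ ^ p := Real.rpow_nonneg (norm_nonneg _) p
  simp only [Pi.add_apply, norm_mul, norm_norm, Real.norm_of_nonneg h4]
  nlinarith [mul_le_mul_of_nonneg_left h3 (norm_nonneg (γ t))]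

theorem integrable_max_neg_mul (hγ : Integrable γ μ) (hγ0 : 0 ≤ᵐ[μ] γ) {v : T → ℝ}
    (hv : AEStronglyMeasurable v μ) {C : ℝ} (hC : ∀ t, C ≤ v t) :
    Integrable (fun t => max (-(γ t * v t)) 0) μ := by
  refine (hγ.mul_const |C|).mono'
    ((hγ.aestronglyMeasurable.mul hv).neg.sup aestronglyMeasurable_const) ?_
  filter_upwards [hγ0] with t ht
  have ht : 0 ≤ γ t := ht
  rw [Real.norm_of_nonneg (le_max_right _ _)]
  refine max_le ?_ (by positivity)
  have h1 := mul_le_mul_of_nonneg_left ((neg_abs_le C).trans (hC t)) ht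
  linarith

theorem tendsto_setIntegral_spanningSets [SigmaFinite μ] (hγ : Integrable γ μ) :
    Tendsto (fun n => ∫ t in spanningSets μ n, γ t ∂μ) atTop (𝓝 (∫ t, γ t ∂μ)) := by
  have := tendsto_setIntegral_of_monotone (measurableSet_spanningSets μ) (monotone_spanningSets μ)
    (f := γ) hγ.integrableOn
  rwa [iUnion_spanningSets, setIntegral_univ] at this

theorem mul_comp_indicator_const {T Y : Type*} [NormedAddCommGroup Y] {γ : T → ℝ}
    (f : Y → ℝ) (s : Set T) (z : Y) :
    (fun t => γ t * f (s.indicator (fun _ => z) t)) =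
      fun t => γ t * f 0 + s.indicator γ t * (f z - f 0) := by
  funext t
  by_cases ht : t ∈ s
  · simp only [Set.indicator_of_mem ht]; ring
  · simp only [Set.indicator_of_notMem ht]; ring

theorem integrable_mul_comp_indicator_const (hγ : Integrable γ μ) (f : Y → ℝ) {s : Set T}
    (hs : MeasurableSet s) (z : Y) :
    Integrable (fun t => γ t * f (s.indicator (fun _ => z) t)) μ := by
  rw [mul_comp_indicator_const]
  exact (hγ.mul_const _).add ((hγ.indicator hs).mul_const _)

theorem integral_mul_comp_indicator_const (hγ : Integrable γ μ) (f : Y → ℝ) {s : Set T}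
    (hs : MeasurableSet s) (z : Y) :
    ∫ t, γ t * f (s.indicator (fun _ => z) t) ∂μ =
      (∫ t, γ t ∂μ) * f 0 + (∫ t in s, γ t ∂μ) * (f z - f 0) := by
  rw [mul_comp_indicator_const, integral_add (hγ.mul_const _) ((hγ.indicator hs).mul_const _),
    integral_mul_const, integral_mul_const, integral_indicator hs]

theorem tendsto_integral_mul_comp_indicator_const [SigmaFinite μ] (hγ : Integrable γ μ)
    (f : Y → ℝ) (z : Y) :
    Tendsto (fun n => ∫ t, γ t * f ((spanningSets μ n).indicator (fun _ => z) t) ∂μ) atTop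
      (𝓝 (f z * ∫ t, γ t ∂μ)) := by
  have h := ((tendsto_setIntegral_spanningSets hγ).mul_const (f z - f 0)).const_add
    ((∫ t, γ t ∂μ) * f 0)
  have he : (∫ t, γ t ∂μ) * f 0 + (∫ t, γ t ∂μ) * (f z - f 0) = f z * ∫ t, γ t ∂μ := by ring
  rw [he] at h
  exact h.congr fun n =>
    (integral_mul_comp_indicator_const hγ f (measurableSet_spanningSets μ n) z).symm

end Integrals

/-! ### The main theorem. -/

theorem theorem4
    {T : Type*} [MeasurableSpace T] (μ : Measure T) [SigmaFinite μ]
    {Y : Type*} [NormedAddCommGroup Y] [NormedSpace ℝ Y] [CompleteSpace Y]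
    (hY : IsReflexiveSpace Y)
    (φ : StrongDual ℝ Y) (hφ : φ ≠ 0)
    (ψ : Y → ℝ) (hψ_lsc : SeqWeaklyLowerSemicontinuous ψ) (hψ : ContDiff ℝ 1 ψ)
    (hψ_lim : Tendsto (fun y : Y => ψ y / ‖y‖) (Bornology.cobounded Y) atTop)
    (hsol : (∀ κ : ℝ, κ < 0 → ∃! y : Y, fderiv ℝ ψ y = κ • φ) ∨
      (FiniteDimensional ℝ Y ∧
        ∀ κ : ℝ, κ < 0 → {y : Y | fderiv ℝ ψ y = κ • φ}.encard ≤ 2))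
    (p : ℝ) (hp : 1 ≤ p)
    (γ : T → ℝ) (hγ_top : MemLp γ ⊤ μ) (hγ_one : MemLp γ 1 μ)
    (hγ_ne : ¬ γ =ᵐ[μ] 0) (hγ_nonneg : 0 ≤ᵐ[μ] γ)
    (r : ℝ) (hr : (⨅ y : Y, (ψ y : EReal)) < (r : EReal)) :
    (∀ u : T → Y, MemLp u (ENNReal.ofReal p) μ →
      Integrable (fun t => γ t * φ (u t)) μ ∧
      AEStronglyMeasurable (fun t => γ t * ψ (u t)) μ ∧
      Integrable (fun t => max (-(γ t * ψ (u t))) 0) μ) ∧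
    ∃ m : ℝ, IsGLB ((fun y : Y => φ y) '' {y : Y | ψ y = r}) m ∧
      IsGLB ((fun u : T → Y => ∫ t, γ t * φ (u t) ∂μ) '' integralSublevel μ p γ ψ r)
        (m * ∫ t, γ t ∂μ) := by
  have hγ : Integrable γ μ := memLp_one_iff_integrable.1 hγ_one
  have hφint : ∀ u : T → Y, MemLp u (ENNReal.ofReal p) μ →
      Integrable (fun t => γ t * φ (u t)) μ := fun u hu => by
    refine ((hγ_top.integrable_mul_norm_of_memLp_top hγ hp hu).norm.const_mul ‖φ‖).mono'
      (hγ.aestronglyMeasurable.mul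
        (φ.continuous.comp_aestronglyMeasurable hu.aestronglyMeasurable))
      (Eventually.of_forall fun t => ?_)
    rw [norm_mul, norm_mul, norm_norm, mul_left_comm]
    exact mul_le_mul_of_nonneg_left (φ.le_opNorm _) (norm_nonneg _)
  have hψm : ∀ u : T → Y, MemLp u (ENNReal.ofReal p) μ →
      AEStronglyMeasurable (fun t => ψ (u t)) μ := fun u hu =>
    hψ.continuous.comp_aestronglyMeasurable hu.aestronglyMeasurable
  obtain ⟨C, hC⟩ := hψ_lsc.bddBelow hY hψ_lim
  refine ⟨fun u hu => ⟨hφint u hu, hγ.aestronglyMeasurable.mul (hψm u hu),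
    integrable_max_neg_mul hγ hγ_nonneg (hψm u hu) fun t => hC (u t)⟩, ?_⟩
  obtain ⟨z, hz⟩ := iInf_lt_iff.1 hr
  obtain ⟨lam, hlam, y, hy, hyr⟩ := exists_isLagrangianMin_eq hY hφ hψ_lsc hψ_lim
    (fun _ hl _ _ ha hb => ha.unique hψ hψ_lim hsol hl hb) (EReal.coe_lt_coe_iff.1 hz)
  have hG : 0 < ∫ t, γ t ∂μ := by
    refine lt_of_le_of_ne (integral_nonneg_of_ae hγ_nonneg) fun h => hγ_ne ?_
    exact (integral_eq_zero_iff_of_nonneg_ae hγ_nonneg hγ).1 h.symm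
  refine ⟨φ y, IsLeast.isGLB ⟨⟨y, hyr, rfl⟩, ?_⟩, ?_, ?_⟩
  · rintro _ ⟨w, hw : ψ w = r, rfl⟩
    have := hy w
    rw [hyr, hw] at this
    simpa using this
  · rintro _ ⟨u, ⟨hu, hui, hule⟩, rfl⟩
    have h1 : ∫ t, γ t * (φ y + lam * r) ∂μ ≤ ∫ t, γ t * φ (u t) + lam * (γ t * ψ (u t)) ∂μ := by
      refine integral_mono_ae (hγ.mul_const _) ((hφint u hu).add (hui.const_mul lam)) ?_
      filter_upwards [hγ_nonneg] with t ht
      have h2 := mul_le_mul_of_nonneg_left (hy (u t)) ht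
      rw [hyr] at h2
      linarith
    rw [integral_mul_const, integral_add (hφint u hu) (hui.const_mul lam),
      integral_const_mul] at h1
    have h3 := mul_le_mul_of_nonneg_left hule hlam.le
    show φ y * ∫ t, γ t ∂μ ≤ ∫ t, γ t * φ (u t) ∂μ
    linarith
  · intro b hb
    have key : ∀ ε : ℝ, 0 < ε → b ≤ (φ y + ε) * ∫ t, γ t ∂μ := fun ε hε => by
      obtain ⟨w, hw1, hw2⟩ := hy.exists_lt hlam hφ (hψ.differentiable one_ne_zero) hε
      rw [hyr] at hw1
      refine le_trans ?_ (mul_le_mul_of_nonneg_right hw2.le hG.le)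
      refine ge_of_tendsto (tendsto_integral_mul_comp_indicator_const hγ (fun x => φ x) w) ?_
      -- Off the spanning set the truncation contributes `ψ 0`, possibly above `r`; since `ψ w < r`,
      -- the constraint still holds for large `n`.
      filter_upwards [(tendsto_integral_mul_comp_indicator_const hγ ψ w).eventually
        (ge_mem_nhds (mul_lt_mul_of_pos_right hw1 hG))] with n hn
      refine hb ⟨(spanningSets μ n).indicator fun _ => w, ⟨?_, ?_, hn⟩, rfl⟩
      · exact memLp_indicator_const _ (measurableSet_spanningSets μ n) w
          (Or.inr (measure_spanningSets_lt_top μ n).ne)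
      · exact integrable_mul_comp_indicator_const hγ ψ (measurableSet_spanningSets μ n) w
    have hc : Tendsto (fun ε : ℝ => (φ y + ε) * ∫ t, γ t ∂μ) (𝓝[>] 0)
        (𝓝 (φ y * ∫ t, γ t ∂μ)) := by
      have : Continuous fun ε : ℝ => (φ y + ε) * ∫ t, γ t ∂μ := by fun_prop
      simpa using (this.tendsto 0).mono_left nhdsWithin_le_nhds
    exact ge_of_tendsto hc (eventually_mem_nhdsWithin.mono key)
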